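/- Let $\mathbf{k}$ be an algebraically closed field of characteristic $0$. A (right) Leibniz algebra over $\mathbf{k}$ is a vector space $L$ with a bilinear bracket satisfying $\langle\langle x,y\rangle,z\rangle=\langle x,\langle y,z\rangle\rangle+\langle\langle x,z\rangle,y\rangle$ for all $x,y,z\in L$. Let $L^{ann}$ be the span of all $\langle x,x\rangle$, $x\in L$; it is a two-sided ideal, and the Lie factor $L/L^{ann}$ is a Lie algebra. $L$ is called simple if $\langle L^{ann},L\rangle\neq 0$ and $L$ has no two-sided ideals other than $0$, $L^{ann}$ and $L$. $L$ is called standard if $L=\bar L\oplus L^{ann}$ as vector spaces for some Lie subalgebra $\bar L$ of $L$ (a subspace closed under the bracket on which $\langle x,x\rangle=0$). For $\alpha,\beta\in\mathbf{k}$ consider the following algebras, where all brackets of basis vectors that are not listed are zero, and $v_j:=0$ for $j\notin\{0,\dots,n\}$. - $s\ell_{2,2}^{\alpha,\beta}$ has the basis $f,h,e,v_0,v_1,v_2$ (so $n=2$) and the brackets $$\langle h,e\rangle=2e+2\alpha v_0,\quad \langle e,h\rangle=-2e,\quad \langle h,f\rangle=-2f+\beta v_2,\quad \langle f,h\rangle=2f,$$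 $$\langle e,f\rangle=h+\alpha v_1,\quad \langle f,e\rangle=-h-\beta v_1,$$ $$\langle v_k,h\rangle=-(2-2k)v_k,\quad \langle v_k,f\rangle=-v_{k+1},\quad \langle v_k,e\rangle=-k(3-k)v_{k-1}\qquad(0\le k\le 2).$$ - For even $n\ge 4$, $s\ell_{2,n}^{\alpha,\beta}$ has the basis $f,h,e,v_0,\dots,v_n$ and the brackets $$\langle e,e\rangle=\alpha v_{\frac n2-2},\quad \langle f,f\rangle=\beta v_{\frac n2+2},\quad \langle h,e\rangle=2e-\alpha v_{\frac n2-1},\quad \langle e,h\rangle=-2e,$$ $$\langle h,f\rangle=-2f+\Big(\tfrac{-4\alpha}{n^2+2n-8}-2\beta\Big)v_{\frac n2+1},\quad \langle f,h\rangle=2f,$$ $$\langle e,f\rangle=h,\quad \langle f,e\rangle=-h+\Big(\tfrac{4\alpha}{n^2+2n-8}+\tfrac{n(n+2)}{4}\beta\Big)v_{\frac n2},$$ $$\langle v_k,h\rangle=-(n-2k)v_k,\quad \langle v_k,f\rangle=-v_{k+1},\quad \langle v_k,e\rangle=-k(n-k+1)v_{k-1}\qquad(0\le k\le n).$$ **Proposition.**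 Let $L$ be a finite-dimensional simple Leibniz algebra over $\mathbf{k}$ whose Lie factor $L/L^{ann}$ is isomorphic to the Lie algebra $s\ell_2(\mathbf{k})$. (i) If $\dim L$ is odd, then $\dim L\ge 5$ and $L$ is standard. (ii) If $\dim L$ is even, then $\dim L\ge 6$ and there exist $\alpha,\beta\in\mathbf{k}$ such that $L$ is isomorphic to $s\ell_{2,2}^{\alpha,\beta}$ if $\dim L=6$, and to $s\ell_{2,n}^{\alpha,\beta}$ with $n=\dim L-4$ if $\dim L>6$. -/

import Mathlib

/-- A (right) Leibniz algebra: a vector space with a bilinear angle bracket satisfying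
`⟨⟨x, y⟩, z⟩ = ⟨x, ⟨y, z⟩⟩ + ⟨⟨x, z⟩, y⟩`. -/
class LeibnizAlgebra (k L : Type*) [Field k] [AddCommGroup L] [Module k L] where
  angle : L →ₗ[k] L →ₗ[k] L
  leibniz : ∀ x y z : L,
    angle (angle x y) z = angle x (angle y z) + angle (angle x z) y

namespace LeibnizAlgebra

section Basic

variable (k L : Type*) [Field k] [AddCommGroup L] [Module k L] [LeibnizAlgebra k L]

/-- The annihilator `L^ann`: the span of all squares `⟨x, x⟩`. -/
def annihilator : Submodule k L :=
  Submodule.span k (Set.range fun x : L => angle (k := k) x x)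

variable {k L}

/-- A (two-sided) ideal of a Leibniz algebra. -/
def IsIdeal (I : Submodule k L) : Prop :=
  ∀ a ∈ I, ∀ x : L, angle (k := k) a x ∈ I ∧ angle (k := k) x a ∈ I

/-- A Lie subalgebra of a Leibniz algebra: a subspace closed under the bracket on which the
bracket is alternating (the Jacobi identity then is the Leibniz identity). -/
def IsLieSubalgebra (S : Submodule k L) : Prop :=
  (∀ x ∈ S, ∀ y ∈ S, angle (k := k) x y ∈ S) ∧ ∀ x ∈ S, angle (k := k) x x = 0

variable (k L)

/-- `L` is simple: `⟨L^ann, L⟩ ≠ 0`, and the only ideals are among `0`, `L^ann` and `L`. -/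
def IsSimple : Prop :=
  (∃ a ∈ annihilator k L, ∃ x : L, angle (k := k) a x ≠ 0) ∧
    ∀ I : Submodule k L, IsIdeal I → I = ⊥ ∨ I = annihilator k L ∨ I = ⊤

/-- `L` is standard: it is the vector space direct sum of a Lie subalgebra and `L^ann`. -/
def IsStandard : Prop :=
  ∃ S : Submodule k L, IsLieSubalgebra S ∧ IsCompl S (annihilator k L)

variable {k L}

theorem angle_self_mem (x : L) : angle (k := k) x x ∈ annihilator k L :=
  Submodule.subset_span ⟨x, rfl⟩

theorem angle_add_swap_mem (x y : L) :
    angle (k := k) x y + angle (k := k) y x ∈ annihilator k L := by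
  have h := sub_mem (sub_mem (angle_self_mem (k := k) (x + y)) (angle_self_mem (k := k) x))
    (angle_self_mem (k := k) y)
  have e : angle (k := k) (x + y) (x + y) - angle (k := k) x x - angle (k := k) y y
      = angle (k := k) x y + angle (k := k) y x := by
    simp only [map_add, LinearMap.add_apply]
    abel
  rwa [e] at h

theorem angle_annihilator (x a : L) (ha : a ∈ annihilator k L) : angle (k := k) x a = 0 := by
  have hle : annihilator k L ≤ LinearMap.ker (angle (k := k) x) := by
    refine Submodule.span_le.2 ?_
    rintro _ ⟨y, rfl⟩
    have h := leibniz (k := k) x y y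
    simpa using h
  exact hle ha

theorem annihilator_angle_mem (a x : L) (ha : a ∈ annihilator k L) :
    angle (k := k) a x ∈ annihilator k L := by
  have h := angle_add_swap_mem (k := k) a x
  rwa [angle_annihilator x a ha, add_zero] at h

variable (k L)

/-- The Lie factor `L / L^ann`. -/
def LieFactor : Type _ := L ⧸ annihilator k L

instance : AddCommGroup (LieFactor k L) := inferInstanceAs (AddCommGroup (L ⧸ annihilator k L))

instance : Module k (LieFactor k L) := inferInstanceAs (Module k (L ⧸ annihilator k L))

/-- The projection `L → L / L^ann`. -/
def LieFactor.mk : L →ₗ[k] LieFactor k L := (annihilator k L).mkQ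

theorem LieFactor.mk_surjective : Function.Surjective (LieFactor.mk k L) :=
  (annihilator k L).mkQ_surjective

variable {k L} in
theorem LieFactor.mk_eq_zero {a : L} : LieFactor.mk k L a = 0 ↔ a ∈ annihilator k L :=
  Submodule.Quotient.mk_eq_zero _

/-- The bracket induced on `L / L^ann` by the angle bracket of `L`. -/
def LieFactor.bracket : LieFactor k L →ₗ[k] LieFactor k L →ₗ[k] LieFactor k L :=
  (annihilator k L).liftQ
    (LinearMap.mk₂ k
      (fun (x : L) (y : LieFactor k L) =>
        (annihilator k L).liftQ (LieFactor.mk k L ∘ₗ angle (k := k) x)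
          (fun a ha => by simp [angle_annihilator x a ha]) y)
      (fun x₁ x₂ y => by
        obtain ⟨y, rfl⟩ := LieFactor.mk_surjective k L y
        exact (congrArg (LieFactor.mk k L) (LinearMap.map_add₂ (angle (k := k)) x₁ x₂ y)).trans
          (map_add _ _ _))
      (fun c x y => by
        obtain ⟨y, rfl⟩ := LieFactor.mk_surjective k L y
        exact (congrArg (LieFactor.mk k L) (LinearMap.map_smul₂ (angle (k := k)) c x y)).trans
          (map_smul _ _ _))
      (fun x y₁ y₂ => map_add _ y₁ y₂)
      (fun c x y => map_smul _ c y))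
    (fun a ha => by
      ext y
      obtain ⟨y, rfl⟩ := LieFactor.mk_surjective k L y
      exact LieFactor.mk_eq_zero.2 (annihilator_angle_mem a y ha))

instance : Bracket (LieFactor k L) (LieFactor k L) := ⟨fun x y => LieFactor.bracket k L x y⟩

variable {k L} in
theorem LieFactor.mk_lie_mk (x y : L) :
    ⁅LieFactor.mk k L x, LieFactor.mk k L y⁆ = LieFactor.mk k L (angle (k := k) x y) :=
  rfl

instance : LieRing (LieFactor k L) where
  add_lie x y z := LinearMap.map_add₂ (LieFactor.bracket k L) x y z
  lie_add x y z := map_add (LieFactor.bracket k L x) y z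
  lie_self x := by
    obtain ⟨x, rfl⟩ := LieFactor.mk_surjective k L x
    rw [LieFactor.mk_lie_mk, LieFactor.mk_eq_zero]
    exact angle_self_mem x
  leibniz_lie x y z := by
    obtain ⟨x, rfl⟩ := LieFactor.mk_surjective k L x
    obtain ⟨y, rfl⟩ := LieFactor.mk_surjective k L y
    obtain ⟨z, rfl⟩ := LieFactor.mk_surjective k L z
    simp only [LieFactor.mk_lie_mk]
    rw [← map_add, ← sub_eq_zero, ← map_sub, LieFactor.mk_eq_zero]
    have h := neg_mem (angle_add_swap_mem (k := k) (angle (k := k) x z) y)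
    rw [leibniz (k := k) x y z]
    convert h using 1
    abel

instance : LieAlgebra k (LieFactor k L) where
  lie_smul c x y := map_smul (LieFactor.bracket k L x) c y

end Basic

section Models

/-- Labels of the basis `f, h, e, v_0, …, v_n`. -/
inductive BasisIndex (n : ℕ) : Type
  | f : BasisIndex n
  | h : BasisIndex n
  | e : BasisIndex n
  | v (j : Fin (n + 1)) : BasisIndex n

variable {k : Type*} [Field k]

/-- The bilinear bracket on the vector space with basis `f, h, e, v_0, …, v_n` whose values on
pairs of basis vectors are given by the table `T`. -/
noncomputable def bracketOfTable {n : ℕ} (T : BasisIndex n → BasisIndex n → (BasisIndex n →₀ k)) :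
    (BasisIndex n →₀ k) →ₗ[k] (BasisIndex n →₀ k) →ₗ[k] (BasisIndex n →₀ k) :=
  Finsupp.linearCombination k fun i => Finsupp.linearCombination k (T i)

noncomputable def vecF (k : Type*) [Field k] (n : ℕ) : BasisIndex n →₀ k := Finsupp.single .f 1

noncomputable def vecH (k : Type*) [Field k] (n : ℕ) : BasisIndex n →₀ k := Finsupp.single .h 1

noncomputable def vecE (k : Type*) [Field k] (n : ℕ) : BasisIndex n →₀ k := Finsupp.single .e 1

/-- The vector `v_j`, with `v_j = 0` for `j ∉ {0, …, n}`. -/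
noncomputable def vecV (k : Type*) [Field k] (n : ℕ) (j : ℤ) : BasisIndex n →₀ k :=
  if hj : 0 ≤ j ∧ j ≤ n then Finsupp.single (.v ⟨j.toNat, by omega⟩) 1 else 0

/-- The multiplication table of `sl_{2,2}^{α,β}`. -/
noncomputable def sl22Table (α β : k) : BasisIndex 2 → BasisIndex 2 → (BasisIndex 2 →₀ k)
  | .h, .e => (2 : k) • vecE k 2 + (2 * α) • vecV k 2 0
  | .e, .h => (-2 : k) • vecE k 2
  | .h, .f => (-2 : k) • vecF k 2 + β • vecV k 2 2
  | .f, .h => (2 : k) • vecF k 2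
  | .e, .f => vecH k 2 + α • vecV k 2 1
  | .f, .e => -vecH k 2 - β • vecV k 2 1
  | .v j, .h => (-(2 - 2 * ((j : ℕ) : k))) • vecV k 2 ((j : ℕ) : ℤ)
  | .v j, .f => -vecV k 2 (((j : ℕ) : ℤ) + 1)
  | .v j, .e => (-(((j : ℕ) : k) * (3 - ((j : ℕ) : k)))) • vecV k 2 (((j : ℕ) : ℤ) - 1)
  | _, _ => 0

/-- The angle bracket of `sl_{2,2}^{α,β}`. -/
noncomputable def sl22 (α β : k) :
    (BasisIndex 2 →₀ k) →ₗ[k] (BasisIndex 2 →₀ k) →ₗ[k] (BasisIndex 2 →₀ k) :=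
  bracketOfTable (sl22Table α β)

/-- The multiplication table of `sl_{2,n}^{α,β}`, to be used for even `n ≥ 4`. -/
noncomputable def sl2nTable (n : ℕ) (α β : k) :
    BasisIndex n → BasisIndex n → (BasisIndex n →₀ k)
  | .e, .e => α • vecV k n (-2 + (n : ℤ) / 2)
  | .f, .f => β • vecV k n (2 + (n : ℤ) / 2)
  | .h, .e => (2 : k) • vecE k n - α • vecV k n (-1 + (n : ℤ) / 2)
  | .e, .h => (-2 : k) • vecE k n
  | .h, .f => (-2 : k) • vecF k n +
      (-4 * α / ((n : k) ^ 2 + 2 * n - 8) - 2 * β) • vecV k n (1 + (n : ℤ) / 2)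
  | .f, .h => (2 : k) • vecF k n
  | .e, .f => vecH k n
  | .f, .e => -vecH k n +
      (4 * α / ((n : k) ^ 2 + 2 * n - 8) + (n : k) * (n + 2) / 4 * β) • vecV k n ((n : ℤ) / 2)
  | .v j, .h => (-((n : k) - 2 * ((j : ℕ) : k))) • vecV k n ((j : ℕ) : ℤ)
  | .v j, .f => -vecV k n (((j : ℕ) : ℤ) + 1)
  | .v j, .e => (-(((j : ℕ) : k) * ((n : k) - ((j : ℕ) : k) + 1))) •
      vecV k n (((j : ℕ) : ℤ) - 1)
  | _, _ => 0

/-- The angle bracket of `sl_{2,n}^{α,β}`, to be used for even `n ≥ 4`. -/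
noncomputable def sl2n (n : ℕ) (α β : k) :
    (BasisIndex n →₀ k) →ₗ[k] (BasisIndex n →₀ k) →ₗ[k] (BasisIndex n →₀ k) :=
  bracketOfTable (sl2nTable n α β)

/-- The Leibniz algebra `L` is isomorphic to the vector space `M` with the bracket `b`: there is
a linear bijection which carries the angle bracket of `L` to `b`. -/
def IsIsomorphicTo (L : Type*) [AddCommGroup L] [Module k L] [LeibnizAlgebra k L]
    {M : Type*} [AddCommGroup M] [Module k M] (b : M →ₗ[k] M →ₗ[k] M) : Prop :=
  ∃ φ : L ≃ₗ[k] M, ∀ x y : L, φ (angle (k := k) x y) = b (φ x) (φ y)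

end Models

end LeibnizAlgebra

/-! The statement reduces to a Levi decomposition: L is always the split extension of `sl₂` by
L^ann, so both (i) and (ii) follow from one normal form, and the parameters α = β = 0 suffice. The
Leibniz identity turns w ↦ -⟨w, x⟩ into a left action on L, and since ⟨L, L^ann⟩ = 0 it depends only
on the class of x in the Lie factor. Thus L is an `sl₂`-module and V = L^ann a submodule with
adjoint quotient. Simplicity makes V irreducible, hence V has a basis x, f x, …, fⁿ x
(`exists_standard_basis`), and ⟨L^ann, L⟩ ≠ 0 gives n ≥ 1. The key step is `exists_primitive_lift`:
a lift of e can be corrected inside V to a highest weight vector w of weight 2. Then w, f w, f² w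
span a module complement of V. Because right multiplication sees only classes modulo V, this
complement is also closed under the bracket and is a copy of `sl₂`; the module structure then gives
the whole multiplication table (`exists_split_basis`). Since dim L = n + 4, the bounds on the
dimension are parity statements about n ≥ 1. -/

section EigenFamily

/-! ### Operators that are diagonalizable on a subspace. -/

variable {k W ι : Type*} [Field k] [AddCommGroup W] [Module k W]
  {h : Module.End k W} {v : ι → W} {μ : ι → k}

theorem apply_sum_eigen [Fintype ι] (hv : ∀ i, h (v i) = μ i • v i) (c : ι → k) (r : k) :
    h (∑ i, c i • v i) - r • ∑ i, c i • v i = ∑ i, (c i * (μ i - r)) • v i := by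
  rw [map_sum, Finset.smul_sum, ← Finset.sum_sub_distrib]
  refine Finset.sum_congr rfl fun i _ => ?_
  rw [map_smul, hv]
  module

/-- On the span of eigenvectors, every vector is the sum of an element of the range of `h - r`
and an element of its kernel. -/
theorem exists_eq_sub_smul_add (hv : ∀ i, h (v i) = μ i • v i) (r : k) {a : W}
    (ha : a ∈ Submodule.span k (Set.range v)) :
    ∃ x ∈ Submodule.span k (Set.range v), ∃ z ∈ Submodule.span k (Set.range v),
      a = h x - r • x + z ∧ h z = r • z := by
  induction ha using Submodule.span_induction with
  | mem a ha =>
    obtain ⟨i, rfl⟩ := ha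
    have hi := Submodule.subset_span (R := k) (Set.mem_range_self (f := v) i)
    by_cases hr : μ i = r
    · exact ⟨0, zero_mem _, v i, hi, by simp, by rw [hv, hr]⟩
    · refine ⟨(μ i - r)⁻¹ • v i, Submodule.smul_mem _ _ hi, 0, zero_mem _, ?_, by simp⟩
      rw [map_smul, hv, smul_comm r, ← smul_sub, ← sub_smul,
        inv_smul_smul₀ (sub_ne_zero.2 hr), add_zero]
  | zero => exact ⟨0, zero_mem _, 0, zero_mem _, by simp, by simp⟩
  | add a b _ _ iha ihb =>
    obtain ⟨x, hx, z, hz, rfl, hz'⟩ := iha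
    obtain ⟨y, hy, t, ht, rfl, ht'⟩ := ihb
    refine ⟨x + y, add_mem hx hy, z + t, add_mem hz ht, ?_, ?_⟩
    · rw [map_add]; module
    · rw [map_add, hz', ht', smul_add]
  | smul c a _ iha =>
    obtain ⟨x, hx, z, hz, rfl, hz'⟩ := iha
    refine ⟨c • x, Submodule.smul_mem _ _ hx, c • z, Submodule.smul_mem _ _ hz, ?_, ?_⟩
    · rw [map_smul]; module
    · rw [map_smul, hz', smul_comm]

/-- A generalized eigenvector of rank two in the span of eigenvectors is an eigenvector. -/
theorem eigen_of_generalized [Fintype ι] (hv : ∀ i, h (v i) = μ i • v i) (hli : LinearIndependent k v)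
    {r : k} {x : W} (hx : x ∈ Submodule.span k (Set.range v))
    (hxx : h (h x - r • x) = r • (h x - r • x)) : h x = r • x := by
  obtain ⟨c, rfl⟩ := (Submodule.mem_span_range_iff_exists_fun k).1 hx
  rw [apply_sum_eigen hv, ← sub_eq_zero, apply_sum_eigen hv] at hxx
  have h0 := Fintype.linearIndependent_iff.1 hli _ hxx
  rw [← sub_eq_zero, apply_sum_eigen hv]
  refine Finset.sum_eq_zero fun i _ => ?_
  have hi := h0 i
  rcases mul_eq_zero.1 hi with hi | hi
  · rw [hi, zero_smul]
  · rw [hi, mul_zero, zero_smul]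

/-- If the eigenvalues are pairwise distinct, an eigenvector in the span is a multiple of
a member of the family. -/
theorem eq_smul_of_eigen [Fintype ι] (hv : ∀ i, h (v i) = μ i • v i) (hli : LinearIndependent k v)
    (hμ : Function.Injective μ) {r : k} {x : W} (hx : x ∈ Submodule.span k (Set.range v))
    (hxr : h x = r • x) (hx0 : x ≠ 0) : ∃ i, ∃ c : k, r = μ i ∧ x = c • v i := by
  obtain ⟨c, rfl⟩ := (Submodule.mem_span_range_iff_exists_fun k).1 hx
  rw [← sub_eq_zero, apply_sum_eigen hv] at hxr
  have h0 := Fintype.linearIndependent_iff.1 hli _ hxr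
  obtain ⟨i, -, hi⟩ := Finset.exists_ne_zero_of_sum_ne_zero hx0
  have hci : c i ≠ 0 := fun h => hi (by rw [h, zero_smul])
  have hri : μ i = r := sub_eq_zero.1 ((mul_eq_zero.1 (h0 i)).resolve_left hci)
  refine ⟨i, c i, hri.symm, Finset.sum_eq_single i (fun j _ hj => ?_) (by simp)⟩
  have hj' : c j = 0 := by
    refine (mul_eq_zero.1 (h0 j)).resolve_right fun h => hj (hμ ?_)
    rw [hri, sub_eq_zero.1 h]
  rw [hj', zero_smul]

end EigenFamily

/-! ### Representations of `sl₂`: highest weight strings and lifting of primitive vectors. -/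

section Sl2Action

/-- The commutation relations of `sl₂` for three operators. -/
structure IsSl2Action {k W : Type*} [Field k] [AddCommGroup W] [Module k W]
    (e h f : Module.End k W) : Prop where
  h_e : ∀ x, h (e x) = e (h x) + (2 : k) • e x
  h_f : ∀ x, h (f x) = f (h x) - (2 : k) • f x
  e_f : ∀ x, e (f x) = f (e x) + h x

variable {k W : Type*} [Field k] [AddCommGroup W] [Module k W] {e h f : Module.End k W}

theorem apply_pow_of_shift {T : Module.End k W} {c : k}
    (hT : ∀ x, h (T x) = T (h x) + c • T x) {x : W} {r : k} (hx : h x = r • x) (m : ℕ) :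
    h ((T ^ m) x) = (r + m * c) • (T ^ m) x := by
  induction m with
  | zero => simp [hx]
  | succ m ih =>
    rw [pow_succ', Module.End.mul_apply, hT, ih, map_smul]
    push_cast
    module

/-- The vectors T^m x lie in eigenspaces for the pairwise distinct values r + m c, so if none
vanished they would be infinitely many independent vectors. -/
theorem exists_pow_apply_eq_zero_of_shift [CharZero k] [Module.Finite k W]
    {T : Module.End k W} {c : k} (hc : c ≠ 0)
    (hT : ∀ x, h (T x) = T (h x) + c • T x) {x : W} {r : k} (hx : h x = r • x) :
    ∃ m : ℕ, (T ^ m) x = 0 := by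
  by_contra! hne
  have hli : LinearIndependent k fun m : ℕ => (T ^ m) x := by
    refine h.eigenvectors_linearIndependent' (fun m : ℕ => r + m * c) (fun i j hij => ?_) _
      fun m => ⟨Module.End.mem_eigenspace_iff.2 (apply_pow_of_shift hT hx m), hne m⟩
    simpa [hc] using hij
  exact Set.infinite_univ (Set.finite_univ_iff.2 hli.finite)

namespace IsSl2Action

theorem h_pow_f (H : IsSl2Action e h f) {x : W} {r : k} (hx : h x = r • x) (j : ℕ) :
    h ((f ^ j) x) = (r - 2 * j) • (f ^ j) x := by
  rw [apply_pow_of_shift (c := -2) (fun y => by rw [H.h_f]; module) hx]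
  congr 1
  ring

/-- Each passage of e across an f adds the current weight, and r + (r - 2) + … + (r - 2j) = (j +
1)(r - j). -/
theorem e_pow_f (H : IsSl2Action e h f) {x : W} {r : k} (hx : h x = r • x) (hex : e x = 0)
    (j : ℕ) : e ((f ^ (j + 1)) x) = ((j + 1) * (r - j)) • (f ^ j) x := by
  induction j with
  | zero => simp [H.e_f, hex, hx]
  | succ j ih =>
    rw [pow_succ', Module.End.mul_apply, H.e_f, ih, map_smul, ← Module.End.mul_apply,
      ← pow_succ', H.h_pow_f hx]
    push_cast
    module

/-- The string of a primitive vector in a finite-dimensional module. -/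
theorem exists_string [CharZero k] [Module.Finite k W] (H : IsSl2Action e h f) {x : W} {r : k}
    (hx : h x = r • x) (hex : e x = 0) (hx0 : x ≠ 0) :
    ∃ n : ℕ, r = n ∧ (f ^ (n + 1)) x = 0 ∧ ∀ j ≤ n, (f ^ j) x ≠ 0 := by
  classical
  have hex0 : ∃ m : ℕ, (f ^ m) x = 0 :=
    exists_pow_apply_eq_zero_of_shift (c := -2) (by norm_num)
      (fun y => by rw [H.h_f]; module) hx
  obtain ⟨n, hn⟩ : ∃ n, Nat.find hex0 = n + 1 :=
    Nat.exists_eq_succ_of_ne_zero fun h0 => hx0 (by simpa [h0] using Nat.find_spec hex0)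
  have hz : (f ^ (n + 1)) x = 0 := hn ▸ Nat.find_spec hex0
  have hnz : ∀ j ≤ n, (f ^ j) x ≠ 0 := fun j hj => Nat.find_min hex0 (by omega)
  refine ⟨n, ?_, hz, hnz⟩
  -- At the end of the string this reads 0 = (n + 1)(r - n) fⁿ x with fⁿ x ≠ 0, which pins the
  -- weight to r = n.
  have h1 := H.e_pow_f hx hex n
  rw [hz, map_zero] at h1
  have h2 := (smul_eq_zero.1 h1.symm).resolve_right (hnz n le_rfl)
  exact sub_eq_zero.1 ((mul_eq_zero.1 h2).resolve_left (Nat.cast_add_one_ne_zero n))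

/-- Raising an eigenvector of h in V by e must stop; the last nonzero vector is primitive. -/
theorem exists_primitive [IsAlgClosed k] [CharZero k] [Module.Finite k W]
    (H : IsSl2Action e h f) {V : Submodule k W} (hV : V ≠ ⊥) (hVe : ∀ x ∈ V, e x ∈ V)
    (hVh : ∀ x ∈ V, h x ∈ V) : ∃ x ∈ V, ∃ r : k, x ≠ 0 ∧ h x = r • x ∧ e x = 0 := by
  classical
  have := (Submodule.nontrivial_iff_ne_bot).2 hV
  obtain ⟨r, hr⟩ := Module.End.exists_eigenvalue (h.restrict hVh)
  obtain ⟨⟨y, hyV⟩, hy⟩ := hr.exists_hasEigenvector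
  have hy0 : y ≠ 0 := fun h0 => hy.2 (Subtype.ext h0)
  have hyr : h y = r • y := congrArg Subtype.val hy.apply_eq_smul
  have hex0 : ∃ m : ℕ, (e ^ m) y = 0 :=
    exists_pow_apply_eq_zero_of_shift two_ne_zero H.h_e hyr
  obtain ⟨n, hn⟩ : ∃ n, Nat.find hex0 = n + 1 :=
    Nat.exists_eq_succ_of_ne_zero fun h0 => hy0 (by simpa [h0] using Nat.find_spec hex0)
  refine ⟨(e ^ n) y, ?_, _, Nat.find_min hex0 (by omega), apply_pow_of_shift H.h_e hyr n, ?_⟩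
  · clear hn
    induction n with
    | zero => exact hyV
    | succ n ih => rw [pow_succ', Module.End.mul_apply]; exact hVe _ ih
  · rw [← Module.End.mul_apply, ← pow_succ', ← hn]
    exact Nat.find_spec hex0

/-- A nonzero irreducible finite-dimensional module has the standard basis `x, f x, …, fⁿ x`. -/
theorem exists_standard_basis [IsAlgClosed k] [CharZero k] [Module.Finite k W]
    (H : IsSl2Action e h f) {V : Submodule k W} (hV : V ≠ ⊥) (hVe : ∀ x ∈ V, e x ∈ V)
    (hVh : ∀ x ∈ V, h x ∈ V) (hVf : ∀ x ∈ V, f x ∈ V)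
    (hirr : ∀ U ≤ V, (∀ x ∈ U, e x ∈ U) → (∀ x ∈ U, h x ∈ U) → (∀ x ∈ U, f x ∈ U) →
      U = ⊥ ∨ U = V) :
    ∃ (n : ℕ) (x : W), h x = (n : k) • x ∧ e x = 0 ∧ (f ^ (n + 1)) x = 0 ∧
      LinearIndependent k (fun j : Fin (n + 1) => (f ^ (j : ℕ)) x) ∧
      V = Submodule.span k (Set.range fun j : Fin (n + 1) => (f ^ (j : ℕ)) x) := by
  obtain ⟨x, hxV, r, hx0, hx, hex⟩ := H.exists_primitive hV hVe hVh
  obtain ⟨n, rfl, hz, hnz⟩ := H.exists_string hx hex hx0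
  refine ⟨n, x, hx, hex, hz, ?_, ?_⟩
  · refine h.eigenvectors_linearIndependent' (fun j : Fin (n + 1) => (n : k) - 2 * (j : ℕ))
      (fun i j hij => ?_) _ fun j =>
        ⟨Module.End.mem_eigenspace_iff.2 (H.h_pow_f hx j), hnz j (by omega)⟩
    simpa [Fin.ext_iff] using hij
  set U := Submodule.span k (Set.range fun j : Fin (n + 1) => (f ^ (j : ℕ)) x) with hU
  have hmem : ∀ j : ℕ, (f ^ j) x ∈ U := by
    intro j
    by_cases hj : j ≤ n
    · exact Submodule.subset_span ⟨⟨j, by omega⟩, rfl⟩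
    · obtain ⟨i, rfl⟩ := Nat.exists_eq_add_of_le (show n + 1 ≤ j by omega)
      rw [add_comm, pow_add, Module.End.mul_apply, hz, map_zero]
      exact zero_mem _
  have hinv : ∀ T : Module.End k W, (∀ j : ℕ, T ((f ^ j) x) ∈ U) → ∀ y ∈ U, T y ∈ U := by
    intro T hT
    have : U ≤ U.comap T := Submodule.span_le.2 (by rintro _ ⟨j, rfl⟩; exact hT j)
    exact this
  have hfV : ∀ j : ℕ, (f ^ j) x ∈ V := by
    intro j
    induction j with
    | zero => exact hxV
    | succ n ih => rw [pow_succ', Module.End.mul_apply]; exact hVf _ ih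
  refine ((hirr U ?_ (hinv e ?_) (hinv h ?_) (hinv f ?_)).resolve_left fun h0 => ?_).symm
  · exact Submodule.span_le.2 (by rintro _ ⟨j, rfl⟩; exact hfV j)
  · rintro (_ | j)
    · simp [hex]
    · rw [H.e_pow_f hx hex]; exact Submodule.smul_mem _ _ (hmem j)
  · intro j
    rw [H.h_pow_f hx]; exact Submodule.smul_mem _ _ (hmem j)
  · intro j
    rw [← Module.End.mul_apply, ← pow_succ']; exact hmem _
  · have := hmem 0
    rw [h0] at this
    exact hx0 (by simpa using this)

/-- A vector `u` which is primitive of weight `2` modulo an irreducible submodule `V`, and whose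
image under `f³` lies in `V`, can be corrected by an element of `V` to a primitive vector. This is
the case of Weyl's theorem on complete reducibility in which the quotient is the adjoint module. -/
theorem exists_primitive_lift [CharZero k]
    (H : IsSl2Action e h f) {V : Submodule k W} {n : ℕ} {x : W}
    (hx : h x = (n : k) • x) (hex : e x = 0)
    (hli : LinearIndependent k (fun j : Fin (n + 1) => (f ^ (j : ℕ)) x))
    (hspan : V = Submodule.span k (Set.range fun j : Fin (n + 1) => (f ^ (j : ℕ)) x))
    (hVe : ∀ x ∈ V, e x ∈ V) (hVf : ∀ x ∈ V, f x ∈ V)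
    {u : W} (hue : e u ∈ V) (huh : h u - (2 : k) • u ∈ V) (huf : f (f (f u)) ∈ V) :
    ∃ w, w - u ∈ V ∧ e w = 0 ∧ h w = (2 : k) • w := by
  have hv : ∀ j : Fin (n + 1), h ((f ^ (j : ℕ)) x) = ((n : k) - 2 * (j : ℕ)) • (f ^ (j : ℕ)) x :=
    fun j => H.h_pow_f hx j
  have hinj : Function.Injective fun j : Fin (n + 1) => (n : k) - 2 * (j : ℕ) := by
    intro i j hij
    simpa [Fin.ext_iff] using hij
  have hwt : ∀ {r : k} {y : W}, y ∈ V → h y = r • y → y ≠ 0 →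
      ∃ (j : ℕ) (c : k), j ≤ n ∧ r = (n : k) - 2 * j ∧ y = c • (f ^ j) x := by
    intro r y hy hyr hy0
    obtain ⟨i, c, h1, h2⟩ := eq_smul_of_eigen hv hli hinj (hspan ▸ hy) hyr hy0
    exact ⟨i, c, by omega, h1, h2⟩
  -- make `h u - 2 u` an eigenvector of weight two
  obtain ⟨y, hy, z, hz, hyz, hz2⟩ := exists_eq_sub_smul_add hv 2 (hspan ▸ huh)
  rw [← hspan] at hy hz
  have hu' : h (u - y) = (2 : k) • (u - y) + z := by
    rw [map_sub, sub_eq_iff_eq_add.1 hyz]; module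
  set u' := u - y with hu'_def
  have hue' : e u' ∈ V := by rw [map_sub]; exact sub_mem hue (hVe _ hy)
  -- Since e raises weights by 2, (h - 4) e u' = e z, and e z itself has weight 4. As h is
  -- semisimple on V, this forces e z = 0.
  have hez : h (e u') - (4 : k) • e u' = e z := by
    rw [H.h_e, hu', map_add, map_smul]; module
  have hez4 : h (e z) = (4 : k) • e z := by
    rw [H.h_e, hz2, map_smul]; module
  have hb : h (e u') = (4 : k) • e u' :=
    eigen_of_generalized hv hli (hspan ▸ hue') (by rw [hez, hez4])
  have hez0 : e z = 0 := by rw [← hez, hb, sub_self]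
  -- kill `e u'`
  obtain ⟨t, ht, ht2, hte⟩ : ∃ t ∈ V, h t = (2 : k) • t ∧ e t = e u' := by
    by_cases hb0 : e u' = 0
    · exact ⟨0, zero_mem _, by simp, by simp [hb0]⟩
    -- Weight 4 means n = 2j + 4, so f^(j+1) x has weight 2 and e sends it to (j + 1)(n - j) f^j x,
    -- a nonzero multiple because j < n.
    obtain ⟨j, c, hj, hnj, hc⟩ := hwt hue' hb hb0
    have hnj' : n = 2 * j + 4 := by
      have : (n : k) = ((2 * j + 4 : ℕ) : k) := by push_cast; linear_combination -hnj
      exact_mod_cast this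
    have hne : ((j : k) + 1) * (n - j) ≠ 0 := by
      refine mul_ne_zero (Nat.cast_add_one_ne_zero j) (sub_ne_zero.2 fun h => ?_)
      have : n = j := by exact_mod_cast h
      omega
    refine ⟨(c * (((j : k) + 1) * (n - j))⁻¹) • (f ^ (j + 1)) x, ?_, ?_, ?_⟩
    · rw [hspan]
      exact Submodule.smul_mem _ _ (Submodule.subset_span ⟨⟨j + 1, by omega⟩, rfl⟩)
    · rw [map_smul, H.h_pow_f hx, smul_comm, hnj']
      congr 1
      push_cast
      ring
    · rw [map_smul, H.e_pow_f hx hex, smul_smul, mul_assoc, inv_mul_cancel₀ hne, mul_one, hc]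
  have hew : e (u' - t) = 0 := by rw [map_sub, hte, sub_self]
  have hhw : h (u' - t) = (2 : k) • (u' - t) + z := by rw [map_sub, hu', ht2]; module
  set w := u' - t with hw_def
  have hwu : w - u ∈ V := by
    have : w - u = -(y + t) := by rw [hw_def, hu'_def]; abel
    rw [this]
    exact neg_mem (add_mem hy ht)
  refine ⟨w, hwu, hew, ?_⟩
  suffices hz0 : z = 0 by rw [hhw, hz0, add_zero]
  -- A nonzero z would give a Jordan block of h in weight 2. As e z = 0, z is a highest weight
  -- vector of V, so n = 2 and V has only the weights 2, 0, -2. This clashes with the action of e on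
  -- f³ w.
  by_contra hz0
  obtain ⟨j, c, hj, hnj, hc⟩ := hwt hz hz2 hz0
  have hc0 : c ≠ 0 := by rintro rfl; exact hz0 (by rw [hc, zero_smul])
  have hvne : ∀ i ≤ n, (f ^ i) x ≠ 0 := fun i hi => hli.ne_zero (⟨i, by omega⟩ : Fin (n + 1))
  obtain rfl : j = 0 := by
    rcases j with _ | j
    · rfl
    rw [hc, map_smul, H.e_pow_f hx hex, smul_eq_zero, smul_eq_zero, mul_eq_zero] at hez0
    rcases hez0 with h0 | (h0 | h0) | h0
    · exact absurd h0 hc0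
    · exact absurd h0 (Nat.cast_add_one_ne_zero j)
    · have : n = j := by exact_mod_cast sub_eq_zero.1 h0
      omega
    · exact absurd h0 (hvne j (by omega))
  have hn2 : n = 2 := by
    have : (n : k) = ((2 : ℕ) : k) := by push_cast; push_cast at hnj; linear_combination -hnj
    exact_mod_cast this
  subst hn2
  -- The off-diagonal term f³ z must vanish before f³ w can be seen as a vector of weight -4.
  have hf3z : f (f (f z)) = 0 := by
    obtain hf := hwt (r := -4) (y := f (f (f z))) (hVf _ (hVf _ (hVf _ hz)))
      (by simp only [H.h_f, hz2, map_sub, map_smul]; module)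
    by_contra hne
    obtain ⟨j, -, hj, hj4, -⟩ := hf hne
    have : (((2 * j : ℕ)) : k) = ((6 : ℕ) : k) := by push_cast at hj4 ⊢; linear_combination hj4
    have : 2 * j = 6 := by exact_mod_cast this
    omega
  have hf3V : f (f (f w)) ∈ V := by
    have : f (f (f w)) = f (f (f (w - u))) + f (f (f u)) := by simp only [map_sub]; abel
    rw [this]
    exact add_mem (hVf _ (hVf _ (hVf _ hwu))) huf
  have hf3w : f (f (f w)) = 0 := by
    have h4 : h (f (f (f w))) = (-4 : k) • f (f (f w)) := by
      simp only [H.h_f, hhw, map_sub, map_add, map_smul, hf3z]; module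
    by_contra hne
    obtain ⟨j, -, hj, hj4, -⟩ := hwt hf3V h4 hne
    have : (((2 * j : ℕ)) : k) = ((6 : ℕ) : k) := by push_cast at hj4 ⊢; linear_combination hj4
    have : 2 * j = 6 := by exact_mod_cast this
    omega
  -- For a vector killed by e one has e f³ w = 3 f² (h - 2) w, and here (h - 2) w = z.
  have hcontra : e (f (f (f w))) = (3 : k) • f (f z) := by
    simp only [H.e_f, H.h_f, hhw, hew, map_sub, map_add, map_smul, map_zero]; module
  rw [hf3w, map_zero, hc, map_smul, map_smul] at hcontra
  refine hvne 2 le_rfl ?_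
  have h3 : (3 * c) • (f ^ 2) x = 0 := by
    rw [mul_smul]; exact hcontra.symm
  exact (smul_eq_zero.1 h3).resolve_left (mul_ne_zero three_ne_zero hc0)

end IsSl2Action

end Sl2Action

namespace LeibnizAlgebra

/-! ### The action of the Lie factor on a Leibniz algebra. -/

section Lifts

variable {k L : Type*} [Field k] [AddCommGroup L] [Module k L] [LeibnizAlgebra k L]

/-- Three elements which lift the standard basis `e`, `h`, `f` of `sl₂` to a Leibniz algebra
with Lie factor `sl₂`. -/
structure IsSl2Lift (E H F : L) : Prop where
  e_f : angle (k := k) E F - H ∈ annihilator k L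
  h_e : angle (k := k) H E - (2 : k) • E ∈ annihilator k L
  h_f : angle (k := k) H F + (2 : k) • F ∈ annihilator k L
  exists_sub_mem : ∀ x : L, ∃ a b c : k, x - (a • E + b • H + c • F) ∈ annihilator k L
  eq_zero_of_mem : ∀ a b c : k, a • E + b • H + c • F ∈ annihilator k L → a = 0 ∧ b = 0 ∧ c = 0

theorem exists_isSl2Lift
    (g : LieFactor k L ≃ₗ⁅k⁆ LieAlgebra.SpecialLinear.sl (Fin 2) k) :
    ∃ E H F : L, IsSl2Lift (k := k) E H F := by
  -- The matrix is a e + b h + c f in the standard basis of `sl₂`.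
  have hmem : ∀ a b c : k, !![b, a; c, -b] ∈ LieAlgebra.SpecialLinear.sl (Fin 2) k := by
    intro a b c
    simp [LieAlgebra.SpecialLinear.sl, Matrix.trace_fin_two]
  have hlift : ∀ a b c : k, ∃ x : L,
      (g (LieFactor.mk k L x) : Matrix (Fin 2) (Fin 2) k) = !![b, a; c, -b] := by
    intro a b c
    obtain ⟨x, hx⟩ := LieFactor.mk_surjective k L (g.symm ⟨_, hmem a b c⟩)
    exact ⟨x, by rw [hx, LieEquiv.apply_symm_apply]⟩
  have hzero : ∀ x : L, x ∈ annihilator k L ↔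
      (g (LieFactor.mk k L x) : Matrix (Fin 2) (Fin 2) k) = 0 := by
    intro x
    rw [← LieFactor.mk_eq_zero, ← map_eq_zero_iff g g.injective, ZeroMemClass.coe_eq_zero]
  have hbr : ∀ x y : L, (g (LieFactor.mk k L (angle (k := k) x y)) : Matrix (Fin 2) (Fin 2) k) =
      g (LieFactor.mk k L x) * g (LieFactor.mk k L y) -
        g (LieFactor.mk k L y) * g (LieFactor.mk k L x) := by
    intro x y
    rw [← LieFactor.mk_lie_mk, LieEquiv.map_lie, LieAlgebra.SpecialLinear.sl_bracket]
  have hadd : ∀ x y : L, (g (LieFactor.mk k L (x + y)) : Matrix (Fin 2) (Fin 2) k) =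
      g (LieFactor.mk k L x) + g (LieFactor.mk k L y) := fun x y => by
    rw [map_add, map_add]; rfl
  have hsub : ∀ x y : L, (g (LieFactor.mk k L (x - y)) : Matrix (Fin 2) (Fin 2) k) =
      g (LieFactor.mk k L x) - g (LieFactor.mk k L y) := fun x y => by
    rw [map_sub, map_sub]; rfl
  have hsmul : ∀ (c : k) (x : L), (g (LieFactor.mk k L (c • x)) : Matrix (Fin 2) (Fin 2) k) =
      c • (g (LieFactor.mk k L x) : Matrix (Fin 2) (Fin 2) k) := fun c x => by
    rw [map_smul, map_smul]; rfl
  obtain ⟨E, hE⟩ := hlift 1 0 0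
  obtain ⟨H, hH⟩ := hlift 0 1 0
  obtain ⟨F, hF⟩ := hlift 0 0 1
  refine ⟨E, H, F, ?_, ?_, ?_, fun x => ?_, fun a b c habc => ?_⟩
  · rw [hzero, hsub, hbr, hE, hF, hH]
    ext i j; fin_cases i <;> fin_cases j <;> simp
  · rw [hzero, hsub, hbr, hsmul, hE, hH]
    ext i j; fin_cases i <;> fin_cases j <;> norm_num [Matrix.mul_apply, Fin.sum_univ_two]
  · rw [hzero, hadd, hbr, hsmul, hF, hH]
    ext i j; fin_cases i <;> fin_cases j <;> norm_num [Matrix.mul_apply, Fin.sum_univ_two]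
  · set M : Matrix (Fin 2) (Fin 2) k := (g (LieFactor.mk k L x) : Matrix (Fin 2) (Fin 2) k)
      with hM
    have htr : M 0 0 + M 1 1 = 0 := by
      have htr0 : M.trace = 0 := (g (LieFactor.mk k L x)).2
      rwa [Matrix.trace_fin_two] at htr0
    refine ⟨M 0 1, M 0 0, M 1 0, ?_⟩
    rw [hzero, hsub, hadd, hadd, hsmul, hsmul, hsmul, hE, hH, hF, ← hM]
    ext i j; fin_cases i <;> fin_cases j <;> simp
    rw [add_comm]; exact htr
  · rw [hzero, hadd, hadd, hsmul, hsmul, hsmul, hE, hH, hF] at habc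
    have h1 := congrFun (congrFun habc 0) 1
    have h2 := congrFun (congrFun habc 0) 0
    have h3 := congrFun (congrFun habc 1) 0
    simp at h1 h2 h3
    exact ⟨h1, h2, h3⟩

/-- The operator `w ↦ -⟨w, x⟩`: the left action of the Lie factor on `L` that corresponds to
right multiplication. -/
def rightAction (x : L) : Module.End k L := -(angle (k := k)).flip x

theorem rightAction_apply (x w : L) : rightAction (k := k) x w = -angle (k := k) w x := rfl

/-- This rests on ⟨L, L^ann⟩ = 0. It allows lifts to be corrected by L^ann without changing their
right multiplications. -/
theorem angle_eq_of_sub_mem {x y : L} (h : x - y ∈ annihilator k L) (w : L) :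
    angle (k := k) w x = angle (k := k) w y := by
  rw [← sub_eq_zero, ← map_sub, angle_annihilator _ _ h]

/-- The Leibniz identity rearranged; the minus sign in `rightAction` is what makes this a
homomorphism rather than an antihomomorphism. -/
theorem rightAction_comm (x y w : L) :
    rightAction (k := k) x (rightAction (k := k) y w) =
      rightAction (k := k) y (rightAction (k := k) x w) +
        rightAction (k := k) (angle (k := k) x y) w := by
  simp only [rightAction_apply, map_neg, neg_neg]
  rw [leibniz w x y]
  abel

theorem rightAction_mem (x : L) {a : L} (ha : a ∈ annihilator k L) :
    rightAction (k := k) x a ∈ annihilator k L :=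
  neg_mem (annihilator_angle_mem a x ha)

namespace IsSl2Lift

variable {E H F : L}

theorem isSl2Action (hl : IsSl2Lift (k := k) E H F) :
    IsSl2Action (rightAction (k := k) E) (rightAction (k := k) H) (rightAction (k := k) F) where
  h_e x := by
    rw [rightAction_comm, rightAction_apply (angle H E), angle_eq_of_sub_mem hl.h_e]
    simp [rightAction_apply]
  h_f x := by
    have := hl.h_f
    rw [← sub_neg_eq_add, ← neg_smul] at this
    rw [rightAction_comm, rightAction_apply (angle H F), angle_eq_of_sub_mem this]
    simp [rightAction_apply]
  e_f x := by
    rw [rightAction_comm, rightAction_apply (angle E F), angle_eq_of_sub_mem hl.e_f]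
    simp [rightAction_apply]

theorem angle_eq (hl : IsSl2Lift (k := k) E H F) (x w : L) : ∃ a b c : k, angle (k := k) w x =
    -(a • rightAction (k := k) E w + b • rightAction (k := k) H w +
      c • rightAction (k := k) F w) := by
  obtain ⟨a, b, c, h⟩ := hl.exists_sub_mem x
  refine ⟨a, b, c, ?_⟩
  rw [angle_eq_of_sub_mem h]
  simp [rightAction_apply]
  abel

/-- A submodule of L^ann is automatically a two-sided ideal, because left multiplication by L kills
L^ann. -/
theorem irreducible (hl : IsSl2Lift (k := k) E H F) (hs : IsSimple k L) {U : Submodule k L} (hU : U ≤ annihilator k L)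
    (he : ∀ x ∈ U, rightAction (k := k) E x ∈ U) (hh : ∀ x ∈ U, rightAction (k := k) H x ∈ U)
    (hf : ∀ x ∈ U, rightAction (k := k) F x ∈ U) : U = ⊥ ∨ U = annihilator k L := by
  have hI : IsIdeal U := by
    intro a ha x
    refine ⟨?_, ?_⟩
    · obtain ⟨r, s, t, h⟩ := hl.angle_eq x a
      rw [h]
      exact neg_mem (add_mem (add_mem (U.smul_mem _ (he a ha)) (U.smul_mem _ (hh a ha)))
        (U.smul_mem _ (hf a ha)))
    · rw [angle_annihilator x a (hU ha)]
      exact zero_mem _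
  rcases hs.2 U hI with h | h | h
  · exact Or.inl h
  · exact Or.inr h
  · exact Or.inr (le_antisymm hU (h ▸ le_top))

end IsSl2Lift

end Lifts

/-! ### The adapted basis and its multiplication table. -/

section Basis

/-- The basis labels as a nested option type. -/
def BasisIndex.equivOption (n : ℕ) : Option (Option (Option (Fin (n + 1)))) ≃ BasisIndex n where
  toFun
    | none => .f
    | some none => .h
    | some (some none) => .e
    | some (some (some j)) => .v j
  invFun
    | .f => none
    | .h => some none
    | .e => some (some none)
    | .v j => some (some (some j))
  left_inv x := by rcases x with _ | _ | _ | _ <;> rfl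
  right_inv x := by cases x <;> rfl

instance (n : ℕ) : Fintype (BasisIndex n) := Fintype.ofEquiv _ (BasisIndex.equivOption n)

theorem BasisIndex.card (n : ℕ) : Fintype.card (BasisIndex n) = n + 4 := by
  rw [← Fintype.card_congr (BasisIndex.equivOption n)]
  simp

theorem BasisIndex.sum {M : Type*} [AddCommMonoid M] {n : ℕ} (g : BasisIndex n → M) :
    ∑ i, g i = g .f + (g .h + (g .e + ∑ j, g (.v j))) := by
  rw [← (BasisIndex.equivOption n).sum_comp, Fintype.sum_option, Fintype.sum_option,
    Fintype.sum_option]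
  rfl

variable {k L : Type*} [Field k] [AddCommGroup L] [Module k L] [LeibnizAlgebra k L]

/-- The family with the given values on the labels. -/
def basisFamily {n : ℕ} (f h e : L) (v : Fin (n + 1) → L) : BasisIndex n → L
  | .f => f
  | .h => h
  | .e => e
  | .v j => v j

/-- Reducing a relation modulo L^ann kills the coefficients of e, h, f, and what remains is a
relation among the v_j. -/
theorem linearIndependent_basisFamily {n : ℕ} {E H F e h f : L} {v : Fin (n + 1) → L}
    (hl : IsSl2Lift (k := k) E H F) (he : e - E ∈ annihilator k L) (hh : h - H ∈ annihilator k L)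
    (hf : f - F ∈ annihilator k L) (hv : LinearIndependent k v)
    (hv' : ∀ j, v j ∈ annihilator k L) : LinearIndependent k (basisFamily f h e v) := by
  rw [Fintype.linearIndependent_iff]
  intro c hc
  rw [BasisIndex.sum] at hc
  have hsum : ∑ j, c (.v j) • v j ∈ annihilator k L :=
    sum_mem fun j _ => Submodule.smul_mem _ _ (hv' j)
  have hmem : c .e • E + c .h • H + c .f • F ∈ annihilator k L := by
    have h1 := neg_mem (add_mem (add_mem (add_mem (Submodule.smul_mem _ (c .e) he)
      (Submodule.smul_mem _ (c .h) hh)) (Submodule.smul_mem _ (c .f) hf)) hsum)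
    have h2 := add_mem h1 (hc ▸ zero_mem (annihilator k L))
    convert h2 using 1
    simp only [basisFamily]
    module
  obtain ⟨h1, h2, h3⟩ := hl.eq_zero_of_mem _ _ _ hmem
  simp only [basisFamily, h1, h2, h3, zero_smul, zero_add] at hc
  have h4 := Fintype.linearIndependent_iff.1 hv _ hc
  rintro (_ | _ | _ | j)
  exacts [h3, h2, h1, h4 j]

theorem span_basisFamily {n : ℕ} {E H F e h f : L} {v : Fin (n + 1) → L}
    (hl : IsSl2Lift (k := k) E H F) (he : e - E ∈ annihilator k L) (hh : h - H ∈ annihilator k L)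
    (hf : f - F ∈ annihilator k L) (hv : annihilator k L = Submodule.span k (Set.range v)) :
    ⊤ ≤ Submodule.span k (Set.range (basisFamily f h e v)) := by
  have hb : ∀ i, basisFamily f h e v i ∈ Submodule.span k (Set.range (basisFamily f h e v)) :=
    fun i => Submodule.subset_span ⟨i, rfl⟩
  have hle : annihilator k L ≤ Submodule.span k (Set.range (basisFamily f h e v)) := by
    rw [hv, Submodule.span_le]
    rintro _ ⟨j, rfl⟩
    exact hb (.v j)
  rintro x -
  obtain ⟨a, b, c, hx⟩ := hl.exists_sub_mem x
  have h1 := sub_mem (sub_mem (sub_mem hx (Submodule.smul_mem _ a he)) (Submodule.smul_mem _ b hh))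
    (Submodule.smul_mem _ c hf)
  have h2 := add_mem (add_mem (add_mem (hle h1) (Submodule.smul_mem _ a (hb .e)))
    (Submodule.smul_mem _ b (hb .h))) (Submodule.smul_mem _ c (hb .f))
  convert h2 using 1
  simp only [basisFamily]
  module

/-- Levi decomposition: a simple Leibniz algebra with Lie factor `sl₂` has a basis whose
multiplication table is that of the split extension, the one with parameters `α = β = 0`. -/
theorem exists_split_basis [IsAlgClosed k] [CharZero k] [Module.Finite k L]
    (hs : IsSimple k L)
    (g : LieFactor k L ≃ₗ⁅k⁆ LieAlgebra.SpecialLinear.sl (Fin 2) k) :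
    ∃ (n : ℕ) (b : Module.Basis (BasisIndex n) k L), 1 ≤ n ∧
      annihilator k L = Submodule.span k (Set.range fun j => b (.v j)) ∧
      ∀ i j, angle (k := k) (b i) (b j) = Finsupp.linearCombination k b (sl2nTable n 0 0 i j) := by
  obtain ⟨E, H, F, hl⟩ := exists_isSl2Lift g
  have A := hl.isSl2Action
  obtain ⟨a, ha, y, hay⟩ := hs.1
  have hV0 : annihilator k L ≠ ⊥ := by
    intro h0
    rw [h0, Submodule.mem_bot] at ha
    exact hay (by rw [ha, map_zero, LinearMap.zero_apply])
  obtain ⟨n, x, hx, hex, hfx, hli, hspan⟩ := A.exists_standard_basis hV0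
    (fun _ => rightAction_mem E) (fun _ => rightAction_mem H) (fun _ => rightAction_mem F)
    (fun _ => hl.irreducible hs)
  -- For n = 0 all of L would act by zero on L^ann, against ⟨L^ann, L⟩ ≠ 0.
  have hn : 1 ≤ n := by
    by_contra hn
    obtain rfl : n = 0 := by omega
    rw [hspan] at ha
    obtain ⟨c, rfl⟩ := (Submodule.mem_span_range_iff_exists_fun k).1 ha
    obtain ⟨r, s, t, h⟩ := hl.angle_eq y (∑ i, c i • (rightAction (k := k) F ^ (i : ℕ)) x)
    apply hay
    rw [h]
    have hfx' : rightAction (k := k) F x = 0 := by simpa using hfx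
    simp [hx, hex, hfx']
  have hEE : angle (k := k) E E ∈ annihilator k L := angle_self_mem E
  have hEH : (2 : k) • E + angle (k := k) E H ∈ annihilator k L := by
    convert sub_mem (angle_add_swap_mem (k := k) H E) hl.h_e using 1
    abel
  obtain ⟨w, hwE, hew, hhw⟩ := A.exists_primitive_lift (u := E) hx hex hli hspan
    (fun _ => rightAction_mem E) (fun _ => rightAction_mem F)
    (by rw [rightAction_apply]; exact neg_mem hEE)
    (by
      rw [rightAction_apply]
      convert neg_mem hEH using 1
      abel)
    (by
      -- Modulo L^ann the action of f sends E to -H, H to 2F and F to 0, so f³ E lies in L^ann.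
      have h1 : rightAction (k := k) F E + H ∈ annihilator k L := by
        rw [rightAction_apply]
        convert neg_mem hl.e_f using 1
        abel
      have h2 := rightAction_mem F (rightAction_mem F h1)
      have h3 : rightAction (k := k) F H - (2 : k) • F ∈ annihilator k L := by
        rw [rightAction_apply]
        convert neg_mem hl.h_f using 1
        abel
      have h4 := rightAction_mem F h3
      have h5 : rightAction (k := k) F F ∈ annihilator k L := neg_mem (angle_self_mem F)
      convert sub_mem (sub_mem h2 h4) (Submodule.smul_mem _ (2 : k) h5) using 1
      simp only [map_add, map_sub, map_smul]
      abel)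
  set eo := rightAction (k := k) E with heo
  set ho := rightAction (k := k) H with hho
  set fo := rightAction (k := k) F with hfo
  have hw0 : w ≠ 0 := by
    rintro rfl
    have := hl.eq_zero_of_mem 1 0 0 (by simpa using neg_mem hwE)
    exact one_ne_zero this.1
  -- The string through w has length fixed by its weight 2, so w, f w, f² w span a submodule.
  have hf3 : fo (fo (fo w)) = 0 := by
    obtain ⟨m, hm, hm0, -⟩ := A.exists_string hhw hew hw0
    have : (m : k) = ((2 : ℕ) : k) := by push_cast; exact hm.symm
    obtain rfl : m = 2 := by exact_mod_cast this
    exact hm0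
  -- The new h and f are dictated by ⟨e, f⟩ = h and ⟨h, f⟩ = -2f, where ⟨y, f⟩ = -`fo` y.
  have hH : -fo w - H ∈ annihilator k L := by
    convert add_mem (annihilator_angle_mem _ F hwE) hl.e_f using 1
    rw [map_sub, LinearMap.sub_apply, hfo, rightAction_apply]
    abel
  have hF : (2⁻¹ : k) • fo (-fo w) - F ∈ annihilator k L := by
    convert Submodule.smul_mem _ (-2⁻¹ : k)
      (add_mem (annihilator_angle_mem _ F hH) hl.h_f) using 1
    rw [map_sub, LinearMap.sub_apply, hfo, rightAction_apply F (-_)]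
    match_scalars <;> norm_num
  let v : Fin (n + 1) → L := fun j => (fo ^ (j : ℕ)) x
  have hvmem : ∀ j, v j ∈ annihilator k L := fun j =>
    hspan ▸ Submodule.subset_span (Set.mem_range_self j)
  let b := Module.Basis.mk (linearIndependent_basisFamily hl hwE hH hF hli hvmem)
    (span_basisFamily hl hwE hH hF hspan)
  have hbf : b .f = (2⁻¹ : k) • fo (-fo w) := Module.Basis.mk_apply ..
  have hbh : b .h = -fo w := Module.Basis.mk_apply ..
  have hbe : b .e = w := Module.Basis.mk_apply ..
  have hbv : ∀ j, b (.v j) = (fo ^ (j : ℕ)) x := fun j => Module.Basis.mk_apply ..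
  have hF' : Finsupp.linearCombination k b (vecF k n) = (2⁻¹ : k) • fo (-fo w) := by
    simp [vecF, hbf]
  have hH' : Finsupp.linearCombination k b (vecH k n) = -fo w := by simp [vecH, hbh]
  have hE' : Finsupp.linearCombination k b (vecE k n) = w := by simp [vecE, hbe]
  have hV' : ∀ j : ℕ, Finsupp.linearCombination k b (vecV k n j) = (fo ^ j) x := by
    intro j
    by_cases hj : j ≤ n
    · simp [vecV, hj, hbv]
    · obtain ⟨i, rfl⟩ := Nat.exists_eq_add_of_le (show n + 1 ≤ j by omega)
      rw [add_comm (n + 1), pow_add, Module.End.mul_apply, hfx, map_zero, vecV, dif_neg (by omega),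
        map_zero]
  -- The new e, h, f have the same right multiplications as E, H, F, so every bracket can be read
  -- off from the module structure.
  have hae : ∀ y, angle (k := k) y (b .e) = -eo y := fun y => by
    rw [hbe, angle_eq_of_sub_mem hwE, heo, rightAction_apply, neg_neg]
  have hah : ∀ y, angle (k := k) y (b .h) = -ho y := fun y => by
    rw [hbh, angle_eq_of_sub_mem hH, hho, rightAction_apply, neg_neg]
  have haf : ∀ y, angle (k := k) y (b .f) = -fo y := fun y => by
    rw [hbf, angle_eq_of_sub_mem hF, hfo, rightAction_apply, neg_neg]
  have hav : ∀ y j, angle (k := k) y (b (.v j)) = 0 := fun y j => by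
    rw [hbv, angle_annihilator _ _ (hvmem j)]
  refine ⟨n, b, hn, by simp only [hbv]; exact hspan, ?_⟩
  rintro (_ | _ | _ | i) (_ | _ | _ | j)
  all_goals
    first
    | rw [haf]
    | rw [hah]
    | rw [hae]
    | rw [hav]
  all_goals
    simp only [sl2nTable, hbf, hbh, hbe, hbv, map_add, map_sub, map_neg, map_smul, map_zero, hF', hH', hE', zero_smul,
      A.h_f, A.e_f, hhw, hew, hf3, mul_zero, zero_div, add_zero, sub_zero]
  · simp
  · match_scalars
    norm_num
  · match_scalars
    norm_num
  · match_scalars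
    norm_num
  · match_scalars
    norm_num
  · match_scalars
    norm_num
  · match_scalars
    norm_num
  · match_scalars
  · rw [show ((i : ℕ) : ℤ) + 1 = ((i + 1 : ℕ) : ℤ) by push_cast; rfl, hV', pow_succ',
      Module.End.mul_apply]
  · rw [hV', A.h_pow_f hx, neg_smul]
  · obtain ⟨_ | i, hi⟩ := i
    · simp [hex]
    · rw [show ((i + 1 : ℕ) : ℤ) - 1 = (i : ℤ) by push_cast; ring, hV', A.e_pow_f hx hex]
      push_cast
      module

end Basis

/-! ### From the multiplication table to the isomorphism and to standardness. -/

section Consequences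

variable {k L : Type*} [Field k] [AddCommGroup L] [Module k L] [LeibnizAlgebra k L]

theorem isIsomorphicTo_bracketOfTable {n : ℕ} (b : Module.Basis (BasisIndex n) k L)
    {T : BasisIndex n → BasisIndex n → (BasisIndex n →₀ k)}
    (hT : ∀ i j, angle (k := k) (b i) (b j) = Finsupp.linearCombination k b (T i j)) :
    IsIsomorphicTo L (bracketOfTable T) := by
  refine ⟨b.repr, fun x y => ?_⟩
  have h : (angle (k := k) (L := L)).compr₂ b.repr.toLinearMap =
      (bracketOfTable T).compl₁₂ b.repr.toLinearMap b.repr.toLinearMap := by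
    refine b.ext fun i => b.ext fun j => ?_
    simp [hT, bracketOfTable]
  exact LinearMap.congr_fun₂ h x y

theorem sl22Table_zero : sl22Table (0 : k) 0 = sl2nTable 2 0 0 := by
  funext i j
  rcases i with _ | _ | _ | i <;> rcases j with _ | _ | _ | j <;> simp [sl22Table, sl2nTable]
  -- Only the coefficients of ⟨v_j, e⟩ still differ in form: 3 - j against 2 - j + 1.
  congr 1
  ring

/-- A Leibniz algebra with the multiplication table of the split extension is standard. -/
theorem isStandard_of_basis {n : ℕ} (b : Module.Basis (BasisIndex n) k L)
    (hV : annihilator k L = Submodule.span k (Set.range fun j => b (.v j)))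
    (hT : ∀ i j, angle (k := k) (b i) (b j) = Finsupp.linearCombination k b (sl2nTable n 0 0 i j)) :
    IsStandard k L := by
  -- The formula is antisymmetric in the two coefficient triples, so it yields both closure under
  -- the bracket and the vanishing of squares.
  have hbr : ∀ p q r p' q' r' : k,
      angle (k := k) (p • b .f + q • b .h + r • b .e) (p' • b .f + q' • b .h + r' • b .e) =
        (2 * (p * q' - q * p')) • b .f + (r * p' - p * r') • b .h +
          (2 * (q * r' - r * q')) • b .e := by
    intro p q r p' q' r'
    simp only [map_add, map_smul, LinearMap.add_apply, LinearMap.smul_apply, hT]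
    simp [sl2nTable, vecF, vecH, vecE]
    module
  let ι := ({.f, .h, .e} : Set (BasisIndex n))
  have hmem : ∀ {x : L}, x ∈ Submodule.span k (b '' ι) ↔
      ∃ p q r : k, p • b .f + q • b .h + r • b .e = x := by
    intro x
    simp only [ι, Set.image_insert_eq, Set.image_singleton, Submodule.mem_span_triple]
  refine ⟨Submodule.span k (b '' ι), ⟨fun x hx y hy => ?_, fun x hx => ?_⟩, ?_⟩
  · obtain ⟨p, q, r, rfl⟩ := hmem.1 hx
    obtain ⟨p', q', r', rfl⟩ := hmem.1 hy
    exact hmem.2 ⟨_, _, _, (hbr _ _ _ _ _ _).symm⟩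
  · obtain ⟨p, q, r, rfl⟩ := hmem.1 hx
    rw [hbr]
    module
  · have hrange : (Set.range fun j => b (.v j)) = b '' ιᶜ := by
      ext x
      constructor
      · rintro ⟨j, rfl⟩
        exact ⟨.v j, by simp [ι], rfl⟩
      · rintro ⟨_ | _ | _ | j, hi, rfl⟩
        · simp [ι] at hi
        · simp [ι] at hi
        · simp [ι] at hi
        · exact ⟨j, rfl⟩
    rw [hV, hrange]
    refine ⟨b.linearIndependent.disjoint_span_image disjoint_compl_right, ?_⟩
    rw [codisjoint_iff, ← Submodule.span_union, ← Set.image_union, Set.union_compl_self,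
      Set.image_univ, b.span_eq]

end Consequences

end LeibnizAlgebra

theorem proposition3p1 {k : Type*} [Field k] [IsAlgClosed k] [CharZero k]
    {L : Type*} [AddCommGroup L] [Module k L] [Module.Finite k L] [LeibnizAlgebra k L]
    (hsimple : LeibnizAlgebra.IsSimple k L)
    (hsl2 : Nonempty (LeibnizAlgebra.LieFactor k L ≃ₗ⁅k⁆ LieAlgebra.SpecialLinear.sl (Fin 2) k)) :
    (Odd (Module.finrank k L) →
      5 ≤ Module.finrank k L ∧ LeibnizAlgebra.IsStandard k L) ∧
    (Even (Module.finrank k L) →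
      6 ≤ Module.finrank k L ∧
      ∃ α β : k,
        (Module.finrank k L = 6 →
          LeibnizAlgebra.IsIsomorphicTo L (LeibnizAlgebra.sl22 α β)) ∧
        (6 < Module.finrank k L →
          LeibnizAlgebra.IsIsomorphicTo L
            (LeibnizAlgebra.sl2n (Module.finrank k L - 4) α β))) := by
  obtain ⟨g⟩ := hsl2
  obtain ⟨n, b, hn, hV, hT⟩ := LeibnizAlgebra.exists_split_basis hsimple g
  have hdim : Module.finrank k L = n + 4 := by
    rw [Module.finrank_eq_card_basis b, LeibnizAlgebra.BasisIndex.card]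
  have hiso := LeibnizAlgebra.isIsomorphicTo_bracketOfTable b hT
  refine ⟨fun _ => ⟨by omega, LeibnizAlgebra.isStandard_of_basis b hV hT⟩, fun heven => ?_⟩
  have hn2 : 2 ≤ n := by
    rcases heven with ⟨m, hm⟩
    omega
  -- the cocycle always splits, so the parameters `α = β = 0` suffice
  refine ⟨by omega, 0, 0, fun h6 => ?_, fun _ => ?_⟩
  · obtain rfl : n = 2 := by omega
    rw [LeibnizAlgebra.sl22, LeibnizAlgebra.sl22Table_zero]
    exact hiso
  · rw [show Module.finrank k L - 4 = n by omega]
    exact hiso
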